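/- **Schwarz lemma for nonsmooth Finsler metrics.** All metrics are written as squared lengths $g(x;v)\ge 0$ of tangent vectors. On the unit disc $\Delta$ let $g_\Delta=\dfrac{|dz|^2}{(1-|z|^2)^2}$ be the Poincaré metric. For a complex manifold $Y$, the infinitesimal Carathéodory metric is $$g_{C}(y;v)=\sup\{(f^*g_\Delta)(y;v) : f:Y\to\Delta \text{ holomorphic}\},$$ and it is called nondegenerate if $g_{C}(y;v)>0$ for all $v\neq0$. The Gauss curvature of a (possibly nonsmooth) metric $g=2\lambda\,dw\otimes d\bar w$ in one complex variable is $$K_g=-\frac1\lambda\frac{\partial^2\log\lambda}{\partial w\,\partial\bar w},\qquad \frac{\partial^2 f}{\partial w\,\partial\bar w}(w_0):=\liminf_{r\to0^+}\frac1{r^2}\Big(\frac1{2\pi}\int_0^{2\pi}f(w_0+re^{i\theta})\,d\theta-f(w_0)\Big)$$ (the usual derivative if $f$ is $C^2$; thus $K_{g_\Delta}=-4$). The holomorphic sectional curvature of a metric $g$ on a complex manifold $X$ in the direction of $0\ne v\in T_xX$ is $\sup_f K_{f^*g}(0)$ over all holomorphic $f:\Delta\to X$ with $f(0)=x$ and $v\in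 f'(0)\,\mathbb C$. Let $X$ be a complex manifold and let $p:Y\to X$ be a holomorphic Galois covering, i.e. a holomorphic covering whose deck transformations act transitively on the fibres (for example the universal covering of $X$, or $p=\mathrm{id}_X$). Assume that the infinitesimal Carathéodory metric of $Y$ is nondegenerate; it is invariant under the automorphisms of $Y$, hence descends to a metric on $X$, again denoted by $g_C$. Let $R=\Delta/\Gamma$ be a compact Riemann surface, the quotient of $\Delta$ by the deck group $\Gamma$ of a holomorphic Galois covering $\Delta\to R$ (so $R$ has genus $\ge2$), with the Hermitian metric $g_R$ obtained by descending $g_\Delta$. Let $\phi:R\to X$ be a nonconstant holomorphic map, and let $k_R,k_C>0$ be constants such that 1. the Gauss curvature of $g_R$ is bounded from below by $-k_R$; 2. the holomorphic sectional curvature of $g_C$ on $X$ is bounded from above by $-k_C$. Then $$\phi^*g_C\le\frac{k_R}{k_C}\,g_R\quad\text{on } R.$$ -/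

import Mathlib

open scoped Manifold ContDiff Topology

noncomputable section

/-- The open unit disc `Δ`, as an open subset of `ℂ`; it is a Riemann surface through the manifold
structure of open subsets. -/
def unitDisc : TopologicalSpace.Opens ℂ := ⟨Metric.ball 0 1, Metric.isOpen_ball⟩

/-- The centre of the unit disc. -/
def discZero : unitDisc := ⟨0, Metric.mem_ball_self one_pos⟩

/-- The Poincaré metric `|dz|² / (1 - |z|²)²` of the unit disc, as the function
`v ↦ |v|² / (1 - |z|²)²` on the tangent bundle.
(All metrics below are functions on tangent bundles, squared lengths of tangent vectors.) -/
def poincareMetric : TangentBundle 𝓘(ℂ, ℂ) unitDisc → ℝ := fun v =>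
  (@norm ℂ _ (mfderiv 𝓘(ℂ, ℂ) 𝓘(ℂ, ℂ) (Subtype.val : unitDisc → ℂ) v.1 v.2)) ^ 2
    / (1 - ‖(v.1 : ℂ)‖ ^ 2) ^ 2

section Manifolds

variable (E : Type*) [NormedAddCommGroup E] [NormedSpace ℂ E]
variable (X : Type*) [TopologicalSpace X] [ChartedSpace E X]

/-- The infinitesimal Carathéodory (pseudo-)metric of a complex manifold `X`:
`g_C(x; v) = sup { (f^* g_Δ)(x; v) | f : X → Δ holomorphic }`, `g_Δ` the Poincaré metric. -/
def caratheodoryMetric : TangentBundle 𝓘(ℂ, E) X → ℝ := fun v =>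
  ⨆ f : {f : X → unitDisc // MDifferentiable 𝓘(ℂ, E) 𝓘(ℂ, ℂ) f},
    poincareMetric (tangentMap 𝓘(ℂ, E) 𝓘(ℂ, ℂ) f.1 v)

variable {E X}

/-- A metric is nondegenerate if it is positive on all nonzero tangent vectors. -/
def NondegenerateMetric (g : TangentBundle 𝓘(ℂ, E) X → ℝ) : Prop :=
  ∀ v : TangentBundle 𝓘(ℂ, E) X, v.2 ≠ 0 → 0 < g v

variable {Y : Type*} [TopologicalSpace Y] [ChartedSpace E Y]

variable (E) in
/-- `p : Y → X` is a holomorphic Galois (normal, regular) covering: a surjective holomorphic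
covering map, locally biholomorphic, whose group `Γ` of deck transformations acts transitively on
the fibres, so that `X = Y / Γ`.
Universal coverings and identity maps are examples. -/
structure IsHolomorphicGaloisCovering (p : Y → X) : Prop where
  isCoveringMap : IsCoveringMap p
  surjective : Function.Surjective p
  isLocalBiholomorphism : IsLocalDiffeomorph 𝓘(ℂ, E) 𝓘(ℂ, E) 1 p
  deck_transitive : ∀ y y' : Y, p y = p y' →
    ∃ σ : Diffeomorph 𝓘(ℂ, E) 𝓘(ℂ, E) Y Y 1, (∀ z, p (σ z) = p z) ∧ σ y = y'

/-- The metric on `X` obtained by descending the metric `g` of `Y` along `p : Y → X`: the length of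
a tangent vector of `X` is that of any of its lifts to `Y`. (For a Galois covering and a metric
that is invariant under biholomorphic maps, all lifts of a vector have the same length.) -/
def descendedMetric (p : Y → X) (g : TangentBundle 𝓘(ℂ, E) Y → ℝ) :
    TangentBundle 𝓘(ℂ, E) X → ℝ :=
  Function.extend (tangentMap 𝓘(ℂ, E) 𝓘(ℂ, E) p) g 0

end Manifolds

/-- The generalized `∂²f / ∂w ∂w̄` at `w₀`:
`liminf_{r → 0+} r⁻² ( (2π)⁻¹ ∫₀^{2π} f (w₀ + r e^{iθ}) dθ - f (w₀) )`.
It is the usual `∂²f / ∂w ∂w̄ = (1/4) Δf` where `f` is twice continuously differentiable. -/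
def lowerDDbar (f : ℂ → ℝ) (w₀ : ℂ) : EReal :=
  Filter.liminf (fun r : ℝ => (((Real.circleAverage f w₀ r - f w₀) / r ^ 2 : ℝ) : EReal)) (𝓝[>] 0)

section RiemannSurface

variable {S : Type*} [TopologicalSpace S] [ChartedSpace ℂ S]

/-- The coefficient `g (∂/∂w)` of a metric on a Riemann surface, in the coordinate `w` given by the
preferred chart at `s`. -/
def metricCoefficient (g : TangentBundle 𝓘(ℂ, ℂ) S → ℝ) (s : S) : ℂ → ℝ := fun w =>
  g (tangentMap 𝓘(ℂ, ℂ) 𝓘(ℂ, ℂ) (chartAt ℂ s).symm ⟨w, (1 : ℂ)⟩)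

/-- The Gauss curvature at `s` of a (possibly nonsmooth) metric, positive near `s`: for
`g = 2 λ dw ⊗ dw̄`, it is `K = - λ⁻¹ ∂² log λ / ∂w ∂w̄`. (In terms of the coefficient `G = 2 λ`,
`K = - (2 / G) ∂² log G / ∂w ∂w̄`.) The Poincaré metric has `K = -4`. -/
def gaussCurvature (g : TangentBundle 𝓘(ℂ, ℂ) S → ℝ) (s : S) : EReal :=
  -(((2 / metricCoefficient g s (chartAt ℂ s s) : ℝ) : EReal) *
    lowerDDbar (fun w => Real.log (metricCoefficient g s w)) (chartAt ℂ s s))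

end RiemannSurface

/-- The holomorphic sectional curvature of a (possibly nonsmooth) nondegenerate metric `g` on a
complex manifold in the direction of a nonzero tangent vector `v` at `x`: the supremum of the Gauss
curvatures at `0` of the pullbacks `f^* g` by the holomorphic discs `f : Δ → X` with `f(0) = x`
that are tangent to `v` at `x`. -/
def holomorphicSectionalCurvature {E : Type*} [NormedAddCommGroup E] [NormedSpace ℂ E]
    {X : Type*} [TopologicalSpace X] [ChartedSpace E X]
    (g : TangentBundle 𝓘(ℂ, E) X → ℝ) (v : TangentBundle 𝓘(ℂ, E) X) : EReal :=
  ⨆ f : {f : unitDisc → X // MDifferentiable 𝓘(ℂ, ℂ) 𝓘(ℂ, E) f ∧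
      ∃ c : ℂ, tangentMap 𝓘(ℂ, ℂ) 𝓘(ℂ, E) f ⟨discZero, c⟩ = v},
    gaussCurvature (g ∘ tangentMap 𝓘(ℂ, ℂ) 𝓘(ℂ, E) f.1) discZero

end

/-!
Everything is pulled back to the unit disc `Δ`. Let `Φ = φ ∘ q : Δ → X`, and let `U` be the ratio of
`Φ^* g_C` and the Poincaré metric `g_Δ` (`poincareRatio`).

The first point is that `g_C` is continuous along holomorphic curves. A curve in `X` lifts locally
to a curve `ψ` in `Y` (`exists_local_lift`), and `ψ^* g_C` is the supremum of the metrics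
`|F'|² / (1 - |F|²)²` over the functions `F = f ∘ ψ`, with `f : Y → Δ` holomorphic. These are
holomorphic functions of one variable from a fixed ball to `Δ`. Postcomposition with Möbius
transformations and the Schwarz lemma show that their hyperbolic derivatives `|F'| / (1 - |F|²)` are
Lipschitz with a common constant (`hyperbolicDeriv_le_add`), hence the supremum is continuous.

By Schwarz–Pick, `g_Δ` is invariant under the deck transformations of `q`, so that `U` is a
continuous function on the compact surface `R`, and attains its maximum at some point `a` of `Δ`
(`exists_max_poincareRatio`). Precompose `Φ` with the Möbius transformation that sends `0` to `a`.
The pullback of `g_C` by the resulting holomorphic disc is at most `U(a) g_Δ`, with equality at `0`,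
so comparison of circle averages of logarithms shows that its Gauss curvature at `0` is at least
`-4 / U(a)` (`lowerDDbar_log_le_two`). The upper bound `-k_C` of the holomorphic sectional curvature
thus gives `U ≤ U(a) ≤ 4 / k_C` (`poincareRatio_le_of_isMax`). Finally, `g_R` has Gauss curvature at
most `-4` somewhere (`gaussCurvature_descendedMetric_poincareMetric_le`), so `4 ≤ k_R`.
-/

open scoped Manifold ContDiff Topology
open Metric Set Filter

/-! ### Hyperbolic derivatives of disc-valued functions -/

/-- The Möbius transformation `w ↦ (w - a) / (1 - ā w)`, which for `‖a‖ < 1` is an automorphism of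
the unit disc that sends `a` to `0` and has inverse `discMoebius (-a)`. -/
noncomputable def discMoebius (a w : ℂ) : ℂ := (w - a) / (1 - (starRingEnd ℂ) a * w)

/-- The square root of `F^* g_Δ (∂/∂z)`, the length of `∂/∂z` in the Poincaré metric pulled back
by a function `F` with values in the unit disc. -/
noncomputable def hyperbolicDeriv (F : ℂ → ℂ) (z : ℂ) : ℝ := ‖deriv F z‖ / (1 - ‖F z‖ ^ 2)

theorem one_sub_conj_mul_ne_zero {a w : ℂ} (ha : ‖a‖ < 1) (hw : ‖w‖ < 1) :
    1 - (starRingEnd ℂ) a * w ≠ 0 := by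
  intro h
  have h1 : (starRingEnd ℂ) a * w = 1 := (sub_eq_zero.mp h).symm
  have h2 : ‖a‖ * ‖w‖ = 1 := by simpa using congrArg norm h1
  nlinarith [norm_nonneg a, norm_nonneg w]

theorem one_sub_normSq_discMoebius {a w : ℂ} (ha : ‖a‖ < 1) (hw : ‖w‖ < 1) :
    1 - ‖discMoebius a w‖ ^ 2 =
      (1 - ‖a‖ ^ 2) * (1 - ‖w‖ ^ 2) / ‖1 - (starRingEnd ℂ) a * w‖ ^ 2 := by
  have h0 : ‖1 - (starRingEnd ℂ) a * w‖ ^ 2 ≠ 0 :=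
    pow_ne_zero _ (norm_ne_zero_iff.mpr (one_sub_conj_mul_ne_zero ha hw))
  rw [discMoebius, norm_div, div_pow, eq_div_iff h0, sub_mul, div_mul_cancel₀ _ h0]
  simp only [Complex.sq_norm, Complex.normSq_apply, Complex.sub_re, Complex.sub_im, Complex.mul_re,
    Complex.mul_im, Complex.conj_re, Complex.conj_im, Complex.one_re, Complex.one_im]
  ring

theorem norm_discMoebius_lt_one {a w : ℂ} (ha : ‖a‖ < 1) (hw : ‖w‖ < 1) :
    ‖discMoebius a w‖ < 1 := by
  have h0 : 0 < ‖1 - (starRingEnd ℂ) a * w‖ := norm_pos_iff.mpr (one_sub_conj_mul_ne_zero ha hw)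
  have h := one_sub_normSq_discMoebius ha hw
  have h1 : 0 < 1 - ‖a‖ ^ 2 := by nlinarith [norm_nonneg a]
  have h2 : 0 < 1 - ‖w‖ ^ 2 := by nlinarith [norm_nonneg w]
  have h3 : 0 < 1 - ‖discMoebius a w‖ ^ 2 := by rw [h]; positivity
  nlinarith [norm_nonneg (discMoebius a w)]

theorem discMoebius_self (a : ℂ) : discMoebius a a = 0 := by simp [discMoebius]

theorem discMoebius_zero (a : ℂ) : discMoebius a 0 = -a := by simp [discMoebius]

theorem hasDerivAt_discMoebius {a w : ℂ} (ha : ‖a‖ < 1) (hw : ‖w‖ < 1) :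
    HasDerivAt (discMoebius a)
      ((1 - ‖a‖ ^ 2 : ℝ) / (1 - (starRingEnd ℂ) a * w) ^ 2) w := by
  have h0 := one_sub_conj_mul_ne_zero ha hw
  have h := ((hasDerivAt_id w).sub_const a).div
    (((hasDerivAt_id w).const_mul ((starRingEnd ℂ) a)).const_sub 1) h0
  refine h.congr_deriv ?_
  have : ((‖a‖ ^ 2 : ℝ) : ℂ) = a * (starRingEnd ℂ) a := by
    rw [Complex.mul_conj, Complex.normSq_eq_norm_sq]
  push_cast at this ⊢
  rw [this]
  simp only [id]
  ring

/-- Möbius transformations are isometries of the Poincaré metric. -/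
theorem hyperbolicDeriv_discMoebius {a w : ℂ} (ha : ‖a‖ < 1) (hw : ‖w‖ < 1) :
    hyperbolicDeriv (discMoebius a) w = 1 / (1 - ‖w‖ ^ 2) := by
  have h0 : ‖1 - (starRingEnd ℂ) a * w‖ ≠ 0 :=
    norm_ne_zero_iff.mpr (one_sub_conj_mul_ne_zero ha hw)
  have h1 : 0 < 1 - ‖a‖ ^ 2 := by nlinarith [norm_nonneg a]
  have h2 : 0 < 1 - ‖w‖ ^ 2 := by nlinarith [norm_nonneg w]
  rw [hyperbolicDeriv, (hasDerivAt_discMoebius ha hw).deriv, one_sub_normSq_discMoebius ha hw,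
    norm_div, norm_pow, Complex.norm_real, Real.norm_of_nonneg h1.le]
  field_simp

theorem hyperbolicDeriv_comp {F m : ℂ → ℂ} {z : ℂ} (hF : DifferentiableAt ℂ F (m z))
    (hm : DifferentiableAt ℂ m z) :
    hyperbolicDeriv (F ∘ m) z = hyperbolicDeriv F (m z) * ‖deriv m z‖ := by
  simp only [hyperbolicDeriv, deriv_comp z hF hm, norm_mul, Function.comp_apply]
  ring

theorem hyperbolicDeriv_nonneg {F : ℂ → ℂ} {z : ℂ} (h : ‖F z‖ < 1) : 0 ≤ hyperbolicDeriv F z :=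
  div_nonneg (norm_nonneg _) (by nlinarith [norm_nonneg (F z)])

theorem norm_deriv_le_hyperbolicDeriv {F : ℂ → ℂ} {z : ℂ} (h : ‖F z‖ < 1) :
    ‖deriv F z‖ ≤ hyperbolicDeriv F z :=
  le_div_self (norm_nonneg _) (by nlinarith [norm_nonneg (F z)]) (by nlinarith [norm_nonneg (F z)])

theorem hyperbolicDeriv_discMoebius_comp {F : ℂ → ℂ} {a z : ℂ} (ha : ‖a‖ < 1)
    (hF : DifferentiableAt ℂ F z) (h : ‖F z‖ < 1) :
    hyperbolicDeriv (discMoebius a ∘ F) z = hyperbolicDeriv F z := by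
  rw [hyperbolicDeriv_comp (hasDerivAt_discMoebius ha h).differentiableAt hF,
    hyperbolicDeriv_discMoebius ha h, hyperbolicDeriv, one_div_mul_eq_div]

/-- Postcomposition with a Möbius transformation normalizes a disc-valued function to vanish at a
given point, and does not change its hyperbolic derivative. -/
theorem exists_normalization {F : ℂ → ℂ} {s : Set ℂ} (hs : IsOpen s) (hF : DifferentiableOn ℂ F s)
    (hmaps : MapsTo F s (ball 0 1)) {z : ℂ} (hz : z ∈ s) :
    ∃ G : ℂ → ℂ, DifferentiableOn ℂ G s ∧ MapsTo G s (ball 0 1) ∧ G z = 0 ∧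
      ∀ w ∈ s, hyperbolicDeriv G w = hyperbolicDeriv F w := by
  have hn : ∀ w ∈ s, ‖F w‖ < 1 := fun w hw => by simpa using hmaps hw
  have hd : ∀ w ∈ s, DifferentiableAt ℂ F w := fun w hw => hF.differentiableAt (hs.mem_nhds hw)
  refine ⟨discMoebius (F z) ∘ F, fun w hw => ?_, fun w hw => ?_, discMoebius_self _, fun w hw => ?_⟩
  · exact ((hasDerivAt_discMoebius (hn z hz) (hn w hw)).differentiableAt.comp w
      (hd w hw)).differentiableWithinAt
  · simpa using norm_discMoebius_lt_one (hn z hz) (hn w hw)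
  · exact hyperbolicDeriv_discMoebius_comp (hn z hz) (hd w hw) (hn w hw)

theorem hyperbolicDeriv_le {F : ℂ → ℂ} {z : ℂ} {r : ℝ} (hr : 0 < r)
    (hF : DifferentiableOn ℂ F (ball z r)) (hmaps : MapsTo F (ball z r) (ball 0 1)) :
    hyperbolicDeriv F z ≤ 1 / r := by
  obtain ⟨G, hG, hGm, hGz, hGF⟩ := exists_normalization isOpen_ball hF hmaps (mem_ball_self hr)
  rw [← hGF z (mem_ball_self hr), hyperbolicDeriv, hGz]
  have h := Complex.norm_deriv_le_div_of_mapsTo_ball (R₂ := 1) hG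
    (by rw [hGz]; exact hGm.mono_right ball_subset_closedBall) hr
  simpa using h

/-- The Schwarz–Pick lemma in the coordinate of the disc. -/
theorem hyperbolicDeriv_le_of_mapsTo {F : ℂ → ℂ} (hF : DifferentiableOn ℂ F (ball 0 1))
    (hmaps : MapsTo F (ball 0 1) (ball 0 1)) {z : ℂ} (hz : ‖z‖ < 1) :
    hyperbolicDeriv F z ≤ 1 / (1 - ‖z‖ ^ 2) := by
  have hz' : ‖-z‖ < 1 := by simpa
  have h00 : ‖(0 : ℂ)‖ < 1 := by simp
  have hm0 : discMoebius (-z) 0 = z := by simp [discMoebius_zero]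
  have hmd : DifferentiableOn ℂ (discMoebius (-z)) (ball 0 1) := fun w hw =>
    (hasDerivAt_discMoebius hz' (by simpa using hw)).differentiableAt.differentiableWithinAt
  have hmm : MapsTo (discMoebius (-z)) (ball 0 1) (ball 0 1) := fun w hw => by
    simpa using norm_discMoebius_lt_one hz' (by simpa using hw)
  have h := hyperbolicDeriv_le one_pos (hF.comp hmd hmm) (hmaps.comp hmm)
  have hmd0 := (hasDerivAt_discMoebius hz' h00).differentiableAt
  have hpos : 0 < 1 - ‖z‖ ^ 2 := by nlinarith [norm_nonneg z]
  have h1 : ‖deriv (discMoebius (-z)) 0‖ = 1 - ‖z‖ ^ 2 := by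
    have := hyperbolicDeriv_discMoebius hz' h00
    rw [hyperbolicDeriv, hm0, norm_zero, div_eq_iff hpos.ne'] at this
    simpa using this
  rw [hyperbolicDeriv_comp, hm0, h1] at h
  · rw [le_div_iff₀ hpos]; simpa using h
  · rw [hm0]; exact hF.differentiableAt (isOpen_ball.mem_nhds (by simpa using hz))
  · exact hmd0

/-- The hyperbolic derivatives of all disc-valued holomorphic functions on a common ball are
Lipschitz near its centre, with a common constant: after normalizing `F` to vanish at `z`, the
hyperbolic derivative is the norm of the derivative at `z`, and at least this norm at `w`. -/
theorem hyperbolicDeriv_le_add {F : ℂ → ℂ} {z₀ z w : ℂ} {r : ℝ} (hr : 0 < r)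
    (hF : DifferentiableOn ℂ F (ball z₀ (4 * r))) (hmaps : MapsTo F (ball z₀ (4 * r)) (ball 0 1))
    (hz : z ∈ ball z₀ r) (hw : w ∈ ball z (2 * r)) :
    hyperbolicDeriv F z ≤ hyperbolicDeriv F w + 2 / r / (2 * r) * dist w z := by
  rw [mem_ball] at hz hw
  have hzs : z ∈ ball z₀ (4 * r) := by rw [mem_ball]; linarith
  have hws : w ∈ ball z₀ (4 * r) := by
    rw [mem_ball]; linarith [dist_triangle w z z₀]
  obtain ⟨G, hG, hGm, hGz, hGF⟩ := exists_normalization isOpen_ball hF hmaps hzs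
  rw [← hGF z hzs, ← hGF w hws]
  have hn : ∀ u ∈ ball z₀ (4 * r), ‖G u‖ < 1 := fun u hu => by simpa using hGm hu
  have hsub : ∀ u ∈ ball z (2 * r), ball u r ⊆ ball z₀ (4 * r) := fun u hu =>
    ball_subset_ball' (by rw [mem_ball] at hu; linarith [dist_triangle u z z₀])
  have hbd : ∀ u ∈ ball z (2 * r), ‖deriv G u‖ ≤ 1 / r := fun u hu =>
    (norm_deriv_le_hyperbolicDeriv (hn u (hsub u hu (mem_ball_self hr)))).trans
      (hyperbolicDeriv_le hr (hG.mono (hsub u hu)) (hGm.mono_left (hsub u hu)))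
  have hz2 : z ∈ ball z (2 * r) := mem_ball_self (by linarith)
  have hmaps' : MapsTo (deriv G) (ball z (2 * r)) (closedBall (deriv G z) (2 / r)) := fun u hu => by
    rw [mem_closedBall, dist_eq_norm]
    calc _ ≤ ‖deriv G u‖ + ‖deriv G z‖ := norm_sub_le _ _
      _ ≤ 1 / r + 1 / r := add_le_add (hbd u hu) (hbd z hz2)
      _ = 2 / r := by ring
  have hdd : DifferentiableOn ℂ (deriv G) (ball z (2 * r)) :=
    (hG.deriv isOpen_ball).mono fun u hu => hsub u hu (mem_ball_self hr)
  have h := Complex.dist_le_div_mul_dist_of_mapsTo_ball hdd hmaps' (mem_ball.mpr hw)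
  calc hyperbolicDeriv G z = ‖deriv G z‖ := by simp [hyperbolicDeriv, hGz]
    _ ≤ ‖deriv G w‖ + dist (deriv G w) (deriv G z) := by
        rw [dist_comm, dist_eq_norm]; exact norm_le_norm_add_norm_sub' _ _
    _ ≤ _ := add_le_add (norm_deriv_le_hyperbolicDeriv (hn w hws)) h

/-- The supremum of the squared hyperbolic derivatives of a family of holomorphic functions from a
common ball to the unit disc is continuous at the centre of the ball. -/
theorem continuousAt_iSup_hyperbolicDeriv_sq {ι : Type*} [Nonempty ι] {F : ι → ℂ → ℂ} {z₀ : ℂ}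
    {ρ : ℝ} (hρ : 0 < ρ) (hF : ∀ i, DifferentiableOn ℂ (F i) (ball z₀ ρ))
    (hmaps : ∀ i, MapsTo (F i) (ball z₀ ρ) (ball 0 1)) :
    ContinuousAt (fun z => ⨆ i, hyperbolicDeriv (F i) z ^ 2) z₀ := by
  obtain ⟨r, hr, rfl⟩ : ∃ r, 0 < r ∧ ρ = 4 * r := ⟨ρ / 4, by positivity, by ring⟩
  have hnn : ∀ z ∈ ball z₀ r, ∀ i, 0 ≤ hyperbolicDeriv (F i) z := fun z hz i =>
    hyperbolicDeriv_nonneg (by simpa using hmaps i (ball_subset_ball (by linarith) hz))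
  have hle : ∀ z ∈ ball z₀ r, ∀ i, hyperbolicDeriv (F i) z ≤ 1 / r := fun z hz i => by
    have hs : ball z r ⊆ ball z₀ (4 * r) :=
      ball_subset_ball' (by rw [mem_ball] at hz; linarith)
    exact hyperbolicDeriv_le hr ((hF i).mono hs) ((hmaps i).mono_left hs)
  -- Without this bound the supremum could be the junk value `0`.
  have hbdd : ∀ z ∈ ball z₀ r, BddAbove (range fun i => hyperbolicDeriv (F i) z ^ 2) :=
    fun z hz => ⟨(1 / r) ^ 2, by
      rintro _ ⟨i, rfl⟩; exact pow_le_pow_left₀ (hnn z hz i) (hle z hz i) 2⟩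
  have key : ∀ z ∈ ball z₀ r, ∀ w ∈ ball z₀ r, (⨆ i, hyperbolicDeriv (F i) z ^ 2) ≤
      (⨆ i, hyperbolicDeriv (F i) w ^ 2) + 2 * (1 / r) * (2 / r / (2 * r)) * dist w z := by
    intro z hz w hw
    refine ciSup_le fun i => ?_
    have hwz : w ∈ ball z (2 * r) := by
      rw [mem_ball] at hz hw ⊢; linarith [dist_triangle_right w z z₀]
    have h1 := hyperbolicDeriv_le_add hr (hF i) (hmaps i) hz hwz
    have h2 := le_ciSup (hbdd w hw) i
    refine le_trans ?_ (add_le_add_left h2 _)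
    have ha := hle z hz i; have hb := hle w hw i
    have ha' := hnn z hz i; have hb' := hnn w hw i
    set a := hyperbolicDeriv (F i) z
    set b := hyperbolicDeriv (F i) w
    have hd : 0 ≤ 2 / r / (2 * r) * dist w z := by positivity
    calc a ^ 2 = b ^ 2 + (a + b) * (a - b) := by ring
      _ ≤ b ^ 2 + (a + b) * (2 / r / (2 * r) * dist w z) := by gcongr; linarith
      _ ≤ b ^ 2 + (2 * (1 / r)) * (2 / r / (2 * r) * dist w z) := by gcongr; linarith
      _ = _ := by ring
  have hz₀ : z₀ ∈ ball z₀ r := mem_ball_self hr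
  rw [ContinuousAt, tendsto_iff_dist_tendsto_zero]
  have hlim : Tendsto (fun z => 2 * (1 / r) * (2 / r / (2 * r)) * dist z z₀) (𝓝 z₀) (𝓝 0) := by
    have : Continuous fun z => 2 * (1 / r) * (2 / r / (2 * r)) * dist z z₀ := by fun_prop
    simpa using this.tendsto z₀
  refine squeeze_zero' (Eventually.of_forall fun _ => dist_nonneg) ?_ hlim
  filter_upwards [isOpen_ball.mem_nhds hz₀] with z hz
  rw [Real.dist_eq, abs_le]
  have h1 := key z hz z₀ hz₀
  have h2 := key z₀ hz₀ z hz
  rw [dist_comm z₀ z] at h1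
  constructor <;> linarith

/-! ### Circle averages of logarithms of conformal metrics -/

theorem eventually_forall_mem_closedBall {P : ℂ → Prop} {w₀ : ℂ} (h : ∀ᶠ w in 𝓝 w₀, P w) :
    ∀ᶠ r : ℝ in 𝓝[>] 0, 0 < r ∧ ∀ w ∈ closedBall w₀ r, P w := by
  obtain ⟨ε, hε, hP⟩ := Metric.eventually_nhds_iff_ball.mp h
  filter_upwards [Ioo_mem_nhdsGT hε] with r hr
  exact ⟨hr.1, fun w hw => hP w (closedBall_subset_ball hr.2 hw)⟩

theorem lowerDDbar_congr {f g : ℂ → ℝ} {w₀ : ℂ} (h : f =ᶠ[𝓝 w₀] g) :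
    lowerDDbar f w₀ = lowerDDbar g w₀ := by
  refine liminf_congr ?_
  filter_upwards [eventually_forall_mem_closedBall h] with r hr
  rw [Real.circleAverage_congr_sphere (f₂ := g) fun w hw => hr.2 w
    (by rw [abs_of_pos hr.1] at hw; exact sphere_subset_closedBall hw), h.self_of_nhds]

/-- A conformal metric on the disc that touches a multiple of the Poincaré metric at `0` from
below has Gauss curvature at least that of this multiple there. -/
theorem lowerDDbar_log_le_two {G : ℂ → ℝ} (hc : ∀ᶠ w in 𝓝 (0 : ℂ), ContinuousAt G w)
    (h0 : 0 < G 0) (hle : ∀ᶠ w in 𝓝 (0 : ℂ), G w ≤ G 0 / (1 - ‖w‖ ^ 2) ^ 2) :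
    lowerDDbar (fun w => Real.log (G w)) 0 ≤ 2 := by
  have hpos : ∀ᶠ w in 𝓝 (0 : ℂ), 0 < G w := hc.self_of_nhds.eventually (lt_mem_nhds h0)
  have hlim : Tendsto (fun r : ℝ => ((2 / (1 - r ^ 2) : ℝ) : EReal)) (𝓝[>] 0) (𝓝 2) := by
    have : ContinuousAt (fun r : ℝ => 2 / (1 - r ^ 2)) 0 :=
      continuousAt_const.div (by fun_prop) (by norm_num)
    have h := this.tendsto.mono_left (nhdsWithin_le_nhds (s := Ioi 0))
    norm_num at h
    exact (continuous_coe_real_ereal.tendsto _).comp h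
  rw [← hlim.liminf_eq]
  refine liminf_le_liminf ?_
  filter_upwards [eventually_forall_mem_closedBall (hc.and (hpos.and hle)),
    Ioo_mem_nhdsGT one_pos] with r ⟨hr, h⟩ hr1
  have hcont : ContinuousOn (fun w => Real.log (G w)) (sphere 0 |r|) := fun w hw => by
    rw [abs_of_pos hr] at hw
    obtain ⟨h1, h2, -⟩ := h w (sphere_subset_closedBall hw)
    exact (h1.log h2.ne').continuousWithinAt
  have hr2 : 0 < 1 - r ^ 2 := by nlinarith [hr1.2]
  have havg : Real.circleAverage (fun w => Real.log (G w)) 0 r ≤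
      Real.log (G 0) - 2 * Real.log (1 - r ^ 2) := by
    refine Real.circleAverage_mono_on_of_le_circle hcont.circleIntegrable' fun w hw => ?_
    rw [abs_of_pos hr] at hw
    obtain ⟨-, h2, h3⟩ := h w (sphere_subset_closedBall hw)
    have hw' : ‖w‖ = r := by simpa using hw
    rw [hw'] at h3
    refine (Real.log_le_log h2 h3).trans_eq ?_
    rw [Real.log_div h0.ne' (pow_ne_zero _ hr2.ne'), Real.log_pow]
    norm_num
  have hlog := Real.one_sub_inv_le_log_of_pos hr2
  rw [EReal.coe_le_coe_iff, div_le_iff₀ (by positivity)]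
  have : 2 / (1 - r ^ 2) * r ^ 2 = -2 * (1 - (1 - r ^ 2)⁻¹) := by field_simp; ring
  rw [this]
  linarith

/-- The Poincaré metric pulled back by a local coordinate `h` of the disc that vanishes at `w₀` has
Gauss curvature at most `-4` at `w₀`: in `log (h^* g_Δ) = 2 log |h'| - 2 log (1 - |h|²)` the first
summand is harmonic and the second is at least `2 |h|²`. -/
theorem two_mul_sq_norm_deriv_le_lowerDDbar {h : ℂ → ℂ} {w₀ : ℂ}
    (hd : ∀ᶠ w in 𝓝 w₀, DifferentiableAt ℂ h w) (h0 : h w₀ = 0) (h0' : deriv h w₀ ≠ 0) :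
    ((2 * ‖deriv h w₀‖ ^ 2 : ℝ) : EReal) ≤
      lowerDDbar (fun w => Real.log (hyperbolicDeriv h w ^ 2)) w₀ := by
  have han : AnalyticAt ℂ h w₀ := Complex.analyticAt_iff_eventually_differentiableAt.mpr hd
  have hne : ∀ᶠ w in 𝓝 w₀, deriv h w ≠ 0 := han.deriv.continuousAt.eventually_ne h0'
  have hlt : ∀ᶠ w in 𝓝 w₀, ‖h w‖ < 1 :=
    han.continuousAt.norm.eventually (gt_mem_nhds (by simp [h0]))
  -- The continuous extension `dslope h w₀` of `h w / (w - w₀)` measures `|h|` on small circles.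
  have hds : ContinuousAt (fun w => 2 * ‖dslope h w₀ w‖ ^ 2) w₀ := by
    have := continuousAt_dslope_same.mpr han.differentiableAt
    fun_prop
  refine EReal.ge_of_forall_gt_iff_ge.mp fun c hc => ?_
  have hc' : ∀ᶠ w in 𝓝 w₀, c < 2 * ‖dslope h w₀ w‖ ^ 2 :=
    hds.eventually (lt_mem_nhds (by simpa [dslope_same] using EReal.coe_lt_coe_iff.mp hc))
  refine le_liminf_of_le (by isBoundedDefault) ?_
  filter_upwards [eventually_forall_mem_closedBall
    (han.eventually_analyticAt.and (hne.and (hlt.and hc')))] with r ⟨hr, H⟩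
  have hsub : sphere w₀ |r| ⊆ closedBall w₀ r := by
    rw [abs_of_pos hr]; exact sphere_subset_closedBall
  have hcont1 : ContinuousOn (fun w => Real.log (hyperbolicDeriv h w ^ 2)) (sphere w₀ |r|) := by
    intro w hw
    obtain ⟨h1, h2, h3, -⟩ := H w (hsub hw)
    have h4 : 0 < 1 - ‖h w‖ ^ 2 := by nlinarith [norm_nonneg (h w)]
    have h5 : ContinuousAt (hyperbolicDeriv h) w :=
      h1.deriv.continuousAt.norm.div (continuousAt_const.sub (h1.continuousAt.norm.pow 2)) h4.ne'
    have h6 : hyperbolicDeriv h w ≠ 0 := div_ne_zero (norm_ne_zero_iff.mpr h2) h4.ne'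
    exact ((h5.pow 2).log (pow_ne_zero _ h6)).continuousWithinAt
  have hcont2 : ContinuousOn (fun w => Real.log ‖deriv h w‖) (sphere w₀ |r|) := by
    intro w hw
    obtain ⟨h1, h2, -⟩ := H w (hsub hw)
    exact (h1.deriv.continuousAt.norm.log (norm_ne_zero_iff.mpr h2)).continuousWithinAt
  have hharm : Real.circleAverage (fun w => Real.log ‖deriv h w‖) w₀ r =
      Real.log ‖deriv h w₀‖ := by
    apply AnalyticOnNhd.circleAverage_log_norm_of_ne_zero
    · intro w hw; rw [abs_of_pos hr] at hw; exact (H w hw).1.deriv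
    · intro w hw; rw [abs_of_pos hr] at hw; exact (H w hw).2.1
  have havg : 2 * Real.log ‖deriv h w₀‖ + c * r ^ 2 ≤
      Real.circleAverage (fun w => Real.log (hyperbolicDeriv h w ^ 2)) w₀ r := by
    have h1 : Real.circleAverage (fun w => (2 : ℝ) • Real.log ‖deriv h w‖ + c * r ^ 2) w₀ r =
        2 * Real.log ‖deriv h w₀‖ + c * r ^ 2 := by
      rw [Real.circleAverage_fun_add
        (f₁ := fun w => (2 : ℝ) • Real.log ‖deriv h w‖)
        (hcont2.const_smul (2 : ℝ)).circleIntegrable' (circleIntegrable_const _ _ _), Real.circleAverage_fun_smul, Real.circleAverage_const,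
        hharm, smul_eq_mul]
    rw [← h1]
    refine Real.circleAverage_mono
      ((hcont2.const_smul (2 : ℝ)).add continuousOn_const).circleIntegrable'
      hcont1.circleIntegrable' fun w hw => ?_
    obtain ⟨-, h2, h3, h4⟩ := H w (hsub hw)
    have h5 : 0 < 1 - ‖h w‖ ^ 2 := by nlinarith [norm_nonneg (h w)]
    have hw' : ‖w - w₀‖ = r := by simpa [abs_of_pos hr, dist_eq_norm] using hw
    have h6 : ‖h w‖ = r * ‖dslope h w₀ w‖ := by
      have := sub_smul_dslope h w₀ w
      rw [h0, sub_zero] at this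
      rw [← this, norm_smul, hw']
    have h7 := Real.log_le_sub_one_of_pos h5
    rw [hyperbolicDeriv, Real.log_pow, Real.log_div (norm_ne_zero_iff.mpr h2) h5.ne', smul_eq_mul]
    push_cast
    nlinarith [sq_nonneg r]
  have h8 : Real.log (hyperbolicDeriv h w₀ ^ 2) = 2 * Real.log ‖deriv h w₀‖ := by
    simp [hyperbolicDeriv, h0]
  rw [EReal.coe_le_coe_iff, le_div_iff₀ (by positivity), h8]
  linarith

/-! ### Tangent maps of curves, and metrics descended along coverings -/

theorem tangentBundle_mk_congr {E : Type*} [NormedAddCommGroup E] [NormedSpace ℂ E] {M : Type*}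
    [TopologicalSpace M] [ChartedSpace E M] {x y : M} {u w : E} (h : x = y) (h' : u = w) :
    (⟨x, u⟩ : TangentBundle 𝓘(ℂ, E) M) = ⟨y, w⟩ := by
  subst h h'; rfl

theorem tangentMap_congr_of_eventuallyEq {E E' : Type*} [NormedAddCommGroup E] [NormedSpace ℂ E]
    [NormedAddCommGroup E'] [NormedSpace ℂ E'] {M N : Type*}
    [TopologicalSpace M] [ChartedSpace E M] [TopologicalSpace N] [ChartedSpace E' N]
    {f g : M → N} {v : TangentBundle 𝓘(ℂ, E) M} (h : f =ᶠ[𝓝 v.1] g) :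
    tangentMap 𝓘(ℂ, E) 𝓘(ℂ, E') f v = tangentMap 𝓘(ℂ, E) 𝓘(ℂ, E') g v := by
  refine tangentBundle_mk_congr h.self_of_nhds ?_
  exact congrArg (fun A : E →L[ℂ] E' => A v.2) h.mfderiv_eq

/-- The inverse of the inclusion of the unit disc in `ℂ` (with junk values outside of the disc). -/
noncomputable def toDisc : ℂ → unitDisc := (chartAt ℂ discZero).symm

theorem norm_coe_lt_one (x : unitDisc) : ‖(x : ℂ)‖ < 1 := by
  have : (x : ℂ) ∈ ball (0 : ℂ) 1 := x.2
  simpa using this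

theorem toDisc_coe (x : unitDisc) : toDisc (x : ℂ) = x := by
  have h : x ∈ (chartAt ℂ discZero).source := by
    simp [TopologicalSpace.Opens.chartAt_eq, chartAt_self_eq]
  exact (chartAt ℂ discZero).left_inv h

theorem coe_toDisc {z : ℂ} (hz : ‖z‖ < 1) : (toDisc z : ℂ) = z := by
  have h : z ∈ ball (0 : ℂ) 1 := by simpa using hz
  exact congrArg Subtype.val (toDisc_coe ⟨z, h⟩)

theorem toDisc_zero : toDisc 0 = discZero := toDisc_coe discZero

theorem mdifferentiable_coe_unitDisc :
    MDifferentiable 𝓘(ℂ, ℂ) 𝓘(ℂ, ℂ) (Subtype.val : unitDisc → ℂ) :=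
  (contMDiff_subtype_val (n := 1)).mdifferentiable one_ne_zero

theorem mdifferentiableAt_toDisc {z : ℂ} (hz : ‖z‖ < 1) :
    MDifferentiableAt 𝓘(ℂ, ℂ) 𝓘(ℂ, ℂ) toDisc z := by
  have h : z ∈ (chartAt ℂ discZero).target := by
    have := (chartAt ℂ discZero).map_source
      (show toDisc z ∈ (chartAt ℂ discZero).source by simp [TopologicalSpace.Opens.chartAt_eq, chartAt_self_eq])
    rwa [show (chartAt ℂ discZero) (toDisc z) = z from coe_toDisc hz] at this
  exact ((contMDiffOn_chart_symm (I := 𝓘(ℂ, ℂ)) (n := 1)).contMDiffAt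
    ((chartAt ℂ discZero).open_target.mem_nhds h)).mdifferentiableAt one_ne_zero

theorem eventually_norm_lt_one {z : ℂ} (hz : ‖z‖ < 1) : ∀ᶠ w in 𝓝 z, ‖w‖ < 1 :=
  continuous_norm.continuousAt.eventually (gt_mem_nhds hz)

/-- Every tangent vector of the disc is that of a curve `toDisc`, so that metrics and tangent maps on
the disc can be computed along functions of one complex variable. -/
theorem exists_eq_tangentMap_toDisc (v : TangentBundle 𝓘(ℂ, ℂ) unitDisc) :
    ∃ z c : ℂ, ‖z‖ < 1 ∧ v = tangentMap 𝓘(ℂ, ℂ) 𝓘(ℂ, ℂ) toDisc ⟨z, c⟩ := by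
  refine ⟨v.1, (tangentMap 𝓘(ℂ, ℂ) 𝓘(ℂ, ℂ) (Subtype.val : unitDisc → ℂ) v).2,
    norm_coe_lt_one _, ?_⟩
  have hid : toDisc ∘ (Subtype.val : unitDisc → ℂ) = id := funext toDisc_coe
  have h := tangentMap_comp_at (I := 𝓘(ℂ, ℂ)) (I' := 𝓘(ℂ, ℂ)) (I'' := 𝓘(ℂ, ℂ)) (g := toDisc) v
    (mdifferentiableAt_toDisc (norm_coe_lt_one v.1)) (mdifferentiable_coe_unitDisc v.1)
  rw [hid, tangentMap_id] at h
  exact h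

theorem poincareMetric_tangentMap {F : ℂ → unitDisc} {z : ℂ} (c : ℂ)
    (hF : MDifferentiableAt 𝓘(ℂ, ℂ) 𝓘(ℂ, ℂ) F z) :
    poincareMetric (tangentMap 𝓘(ℂ, ℂ) 𝓘(ℂ, ℂ) F ⟨z, c⟩) =
      ‖c‖ ^ 2 * hyperbolicDeriv (fun w => (F w : ℂ)) z ^ 2 := by
  have h : mfderiv 𝓘(ℂ, ℂ) 𝓘(ℂ, ℂ) (Subtype.val : unitDisc → ℂ) (F z)
      (mfderiv 𝓘(ℂ, ℂ) 𝓘(ℂ, ℂ) F z c) = c * deriv (fun w => (F w : ℂ)) z := by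
    have h1 := mfderiv_comp z (mdifferentiable_coe_unitDisc (F z)) hF
    rw [mfderiv_eq_fderiv] at h1
    have h2 := congrArg (fun A : ℂ →L[ℂ] ℂ => A c) h1
    refine h2.symm.trans ?_
    rw [fderiv_eq_smul_deriv]
    rfl
  change @norm ℂ _ (mfderiv 𝓘(ℂ, ℂ) 𝓘(ℂ, ℂ) (Subtype.val : unitDisc → ℂ) (F z)
      (mfderiv 𝓘(ℂ, ℂ) 𝓘(ℂ, ℂ) F z c)) ^ 2 / (1 - ‖(F z : ℂ)‖ ^ 2) ^ 2 = _
  rw [h, norm_mul, hyperbolicDeriv, mul_pow, div_pow, mul_div_assoc]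

theorem hyperbolicDeriv_toDisc {z : ℂ} (hz : ‖z‖ < 1) :
    hyperbolicDeriv (fun w => (toDisc w : ℂ)) z = 1 / (1 - ‖z‖ ^ 2) := by
  have h : (fun w => (toDisc w : ℂ)) =ᶠ[𝓝 z] id :=
    (eventually_norm_lt_one hz).mono fun w hw => coe_toDisc hw
  rw [hyperbolicDeriv, h.deriv_eq, coe_toDisc hz]
  simp

theorem poincareMetric_tangentMap_toDisc {z : ℂ} (c : ℂ) (hz : ‖z‖ < 1) :
    poincareMetric (tangentMap 𝓘(ℂ, ℂ) 𝓘(ℂ, ℂ) toDisc ⟨z, c⟩) =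
      ‖c‖ ^ 2 * (1 / (1 - ‖z‖ ^ 2)) ^ 2 := by
  rw [poincareMetric_tangentMap c (mdifferentiableAt_toDisc hz), hyperbolicDeriv_toDisc hz]

/-- The Schwarz–Pick lemma: holomorphic self-maps of the disc contract the Poincaré metric. -/
theorem poincareMetric_tangentMap_le {F : unitDisc → unitDisc}
    (hF : MDifferentiable 𝓘(ℂ, ℂ) 𝓘(ℂ, ℂ) F) (v : TangentBundle 𝓘(ℂ, ℂ) unitDisc) :
    poincareMetric (tangentMap 𝓘(ℂ, ℂ) 𝓘(ℂ, ℂ) F v) ≤ poincareMetric v := by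
  obtain ⟨z, c, hz, rfl⟩ := exists_eq_tangentMap_toDisc v
  have hmd : ∀ w : ℂ, ‖w‖ < 1 → MDifferentiableAt 𝓘(ℂ, ℂ) 𝓘(ℂ, ℂ) (F ∘ toDisc) w :=
    fun w hw => (hF _).comp w (mdifferentiableAt_toDisc hw)
  rw [← tangentMap_comp_at (p := (⟨z, c⟩ : TangentBundle 𝓘(ℂ, ℂ) ℂ)) (hF _)
    (mdifferentiableAt_toDisc hz), poincareMetric_tangentMap c (hmd z hz),
    poincareMetric_tangentMap_toDisc c hz]
  have hnn : 0 ≤ hyperbolicDeriv (fun w => ((F ∘ toDisc) w : ℂ)) z :=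
    hyperbolicDeriv_nonneg (norm_coe_lt_one _)
  have hle : hyperbolicDeriv (fun w => ((F ∘ toDisc) w : ℂ)) z ≤ 1 / (1 - ‖z‖ ^ 2) := by
    refine hyperbolicDeriv_le_of_mapsTo (fun w hw => ?_) (fun w _ => (F (toDisc w)).2) hz
    have := (mdifferentiable_coe_unitDisc _).comp w (hmd w (by simpa using hw))
    exact (mdifferentiableAt_iff_differentiableAt.mp this).differentiableWithinAt
  gcongr

theorem poincareMetric_tangentMap_diffeomorph (σ : Diffeomorph 𝓘(ℂ, ℂ) 𝓘(ℂ, ℂ) unitDisc unitDisc 1)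
    (v : TangentBundle 𝓘(ℂ, ℂ) unitDisc) :
    poincareMetric (tangentMap 𝓘(ℂ, ℂ) 𝓘(ℂ, ℂ) σ v) = poincareMetric v := by
  have h1 := σ.contMDiff.mdifferentiable one_ne_zero
  have h2 := σ.symm.contMDiff.mdifferentiable one_ne_zero
  refine (poincareMetric_tangentMap_le h1 v).antisymm ?_
  have h := poincareMetric_tangentMap_le h2 (tangentMap 𝓘(ℂ, ℂ) 𝓘(ℂ, ℂ) σ v)
  rw [← tangentMap_comp_at v (h2 _) (h1 _)] at h
  have hid : (σ.symm : unitDisc → unitDisc) ∘ σ = id := funext σ.symm_apply_apply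
  rwa [hid, tangentMap_id] at h

section

variable {E : Type*} [NormedAddCommGroup E] [NormedSpace ℂ E]
  {X : Type*} [TopologicalSpace X] [ChartedSpace E X]
  {Y : Type*} [TopologicalSpace Y] [ChartedSpace E Y]

theorem caratheodoryMetric_tangentMap_diffeomorph (σ : Diffeomorph 𝓘(ℂ, E) 𝓘(ℂ, E) Y Y 1)
    (v : TangentBundle 𝓘(ℂ, E) Y) :
    caratheodoryMetric E Y (tangentMap 𝓘(ℂ, E) 𝓘(ℂ, E) σ v) = caratheodoryMetric E Y v := by
  have h1 := σ.contMDiff.mdifferentiable one_ne_zero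
  have h2 := σ.symm.contMDiff.mdifferentiable one_ne_zero
  refine Function.Surjective.iSup_congr (fun f => ⟨f.1 ∘ σ, f.2.comp h1⟩) (fun f => ?_) fun f => ?_
  · refine ⟨⟨f.1 ∘ σ.symm, f.2.comp h2⟩, Subtype.ext ?_⟩
    funext y
    simp
  · rw [tangentMap_comp_at v (f.2 _) (h1 _)]

/-- The descended metric does not depend on the chosen lift: two lifts of a tangent vector differ by
a deck transformation, because the covering is injective on tangent spaces. -/
theorem descendedMetric_tangentMap {p : Y → X} (hp : IsHolomorphicGaloisCovering E p)
    {g : TangentBundle 𝓘(ℂ, E) Y → ℝ}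
    (hg : ∀ (σ : Diffeomorph 𝓘(ℂ, E) 𝓘(ℂ, E) Y Y 1) (v : TangentBundle 𝓘(ℂ, E) Y),
      g (tangentMap 𝓘(ℂ, E) 𝓘(ℂ, E) σ v) = g v) (v : TangentBundle 𝓘(ℂ, E) Y) :
    descendedMetric p g (tangentMap 𝓘(ℂ, E) 𝓘(ℂ, E) p v) = g v := by
  classical
  have hp1 := hp.isLocalBiholomorphism.mdifferentiable one_ne_zero
  have hex : ∃ w, tangentMap 𝓘(ℂ, E) 𝓘(ℂ, E) p w = tangentMap 𝓘(ℂ, E) 𝓘(ℂ, E) p v := ⟨v, rfl⟩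
  rw [descendedMetric, Function.extend_def, dif_pos hex]
  have hwv := Classical.choose_spec hex
  generalize Classical.choose hex = w at hwv ⊢
  obtain ⟨σ, hσ, hσw⟩ := hp.deck_transitive w.1 v.1 (congrArg (fun u => u.1) hwv)
  have hpσ : p ∘ σ = p := funext hσ
  have h : tangentMap 𝓘(ℂ, E) 𝓘(ℂ, E) p (tangentMap 𝓘(ℂ, E) 𝓘(ℂ, E) σ w) =
      tangentMap 𝓘(ℂ, E) 𝓘(ℂ, E) p v := by
    rw [← tangentMap_comp_at w (hp1 _) (σ.contMDiff.mdifferentiable one_ne_zero _), hpσ, hwv]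
  suffices tangentMap 𝓘(ℂ, E) 𝓘(ℂ, E) σ w = v by rw [← hg σ w, this]
  generalize hu : tangentMap 𝓘(ℂ, E) 𝓘(ℂ, E) σ w = u at h
  replace hu : u.1 = v.1 := by rw [← hu]; exact hσw
  obtain ⟨y, a⟩ := u
  obtain ⟨y', b⟩ := v
  obtain rfl : y = y' := hu
  refine tangentBundle_mk_congr rfl ?_
  have hab : mfderiv 𝓘(ℂ, E) 𝓘(ℂ, E) p y a = mfderiv 𝓘(ℂ, E) 𝓘(ℂ, E) p y b := by
    simpa [tangentMap] using h
  rw [← (hp.isLocalBiholomorphism y).mfderivToContinuousLinearEquiv_coe one_ne_zero] at hab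
  exact ((hp.isLocalBiholomorphism y).mfderivToContinuousLinearEquiv one_ne_zero).injective hab

/-- Holomorphic curves lift locally to a holomorphic covering, through any point above. -/
theorem exists_local_lift {p : Y → X} (hp : IsLocalDiffeomorph 𝓘(ℂ, E) 𝓘(ℂ, E) 1 p) {γ : ℂ → X}
    {z₀ : ℂ} {y₀ : Y} (hγ : ∀ᶠ z in 𝓝 z₀, MDifferentiableAt 𝓘(ℂ, ℂ) 𝓘(ℂ, E) γ z)
    (hy₀ : p y₀ = γ z₀) :
    ∃ ψ : ℂ → Y, ψ z₀ = y₀ ∧ ∀ᶠ z in 𝓝 z₀, MDifferentiableAt 𝓘(ℂ, ℂ) 𝓘(ℂ, E) ψ z ∧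
      ∀ c : ℂ, tangentMap 𝓘(ℂ, ℂ) 𝓘(ℂ, E) γ ⟨z, c⟩ =
        tangentMap 𝓘(ℂ, E) 𝓘(ℂ, E) p (tangentMap 𝓘(ℂ, ℂ) 𝓘(ℂ, E) ψ ⟨z, c⟩) := by
  have hL := hp y₀
  have hp1 := hp.mdifferentiable one_ne_zero
  have hmem : ∀ᶠ z in 𝓝 z₀, γ z ∈ hL.localInverse.source :=
    hγ.self_of_nhds.continuousAt.eventually
      (hL.localInverse_open_source.mem_nhds (hy₀ ▸ hL.localInverse_mem_source))
  refine ⟨hL.localInverse ∘ γ, ?_, ?_⟩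
  · rw [Function.comp_apply, ← hy₀]
    exact hL.localInverse_left_inv hL.localInverse_mem_target
  · filter_upwards [hγ, hmem.eventually_nhds] with z hz hmz
    have hd : MDifferentiableAt 𝓘(ℂ, ℂ) 𝓘(ℂ, E) (hL.localInverse ∘ γ) z :=
      (hL.localInverse.mdifferentiableAt one_ne_zero hmz.self_of_nhds).comp z hz
    refine ⟨hd, fun c => ?_⟩
    rw [← tangentMap_comp_at (p := (⟨z, c⟩ : TangentBundle 𝓘(ℂ, ℂ) ℂ)) (hp1 _) hd]
    exact tangentMap_congr_of_eventuallyEq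
      (hmz.mono fun w hw => (hL.localInverse_right_inv hw).symm)

/-- Along a holomorphic curve `ψ`, the Carathéodory metric is a supremum over a family of holomorphic
functions of one variable. -/
theorem caratheodoryMetric_tangentMap {ψ : ℂ → Y} {z : ℂ} (c : ℂ)
    (hψ : MDifferentiableAt 𝓘(ℂ, ℂ) 𝓘(ℂ, E) ψ z) :
    caratheodoryMetric E Y (tangentMap 𝓘(ℂ, ℂ) 𝓘(ℂ, E) ψ ⟨z, c⟩) =
      ‖c‖ ^ 2 * ⨆ f : {f : Y → unitDisc // MDifferentiable 𝓘(ℂ, E) 𝓘(ℂ, ℂ) f},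
        hyperbolicDeriv (fun w => (f.1 (ψ w) : ℂ)) z ^ 2 := by
  rw [Real.mul_iSup_of_nonneg (by positivity)]
  refine iSup_congr fun f => ?_
  rw [← tangentMap_comp_at (p := (⟨z, c⟩ : TangentBundle 𝓘(ℂ, ℂ) ℂ)) (f.2 _) hψ]
  exact poincareMetric_tangentMap c ((f.2 _).comp z hψ)

theorem descendedMetric_caratheodoryMetric_homogeneous {p : Y → X}
    (hp : IsHolomorphicGaloisCovering E p) {γ : ℂ → X} {z : ℂ}
    (hγ : ∀ᶠ w in 𝓝 z, MDifferentiableAt 𝓘(ℂ, ℂ) 𝓘(ℂ, E) γ w) (c : ℂ) :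
    descendedMetric p (caratheodoryMetric E Y) (tangentMap 𝓘(ℂ, ℂ) 𝓘(ℂ, E) γ ⟨z, c⟩) =
      ‖c‖ ^ 2 * descendedMetric p (caratheodoryMetric E Y)
        (tangentMap 𝓘(ℂ, ℂ) 𝓘(ℂ, E) γ ⟨z, (1 : ℂ)⟩) := by
  obtain ⟨y, hy⟩ := hp.surjective (γ z)
  obtain ⟨ψ, -, hψ⟩ := exists_local_lift hp.isLocalBiholomorphism hγ hy
  obtain ⟨h1, h2⟩ := hψ.self_of_nhds
  rw [h2, h2, descendedMetric_tangentMap hp caratheodoryMetric_tangentMap_diffeomorph,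
    descendedMetric_tangentMap hp caratheodoryMetric_tangentMap_diffeomorph,
    caratheodoryMetric_tangentMap c h1, caratheodoryMetric_tangentMap 1 h1]
  simp

/-- The Carathéodory metric is continuous along holomorphic curves. -/
theorem continuousAt_descendedMetric_caratheodoryMetric {p : Y → X}
    (hp : IsHolomorphicGaloisCovering E p) {γ : ℂ → X} {z₀ : ℂ}
    (hγ : ∀ᶠ w in 𝓝 z₀, MDifferentiableAt 𝓘(ℂ, ℂ) 𝓘(ℂ, E) γ w) :
    ContinuousAt (fun z => descendedMetric p (caratheodoryMetric E Y)
      (tangentMap 𝓘(ℂ, ℂ) 𝓘(ℂ, E) γ ⟨z, (1 : ℂ)⟩)) z₀ := by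
  obtain ⟨y, hy⟩ := hp.surjective (γ z₀)
  obtain ⟨ψ, -, hψ⟩ := exists_local_lift hp.isLocalBiholomorphism hγ hy
  obtain ⟨ρ, hρ, hball⟩ := Metric.eventually_nhds_iff_ball.mp hψ
  have : Nonempty {f : Y → unitDisc // MDifferentiable 𝓘(ℂ, E) 𝓘(ℂ, ℂ) f} :=
    ⟨⟨fun _ => discZero, mdifferentiable_const⟩⟩
  refine (continuousAt_iSup_hyperbolicDeriv_sq hρ
    (F := fun (f : {f : Y → unitDisc // MDifferentiable 𝓘(ℂ, E) 𝓘(ℂ, ℂ) f}) w =>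
      (f.1 (ψ w) : ℂ)) (fun f z hz => ?_) (fun f z _ => (f.1 (ψ z)).2)).congr ?_
  · have h1 := (f.2 _).comp z (hball z hz).1
    have h2 := (mdifferentiable_coe_unitDisc _).comp z h1
    exact (mdifferentiableAt_iff_differentiableAt.mp h2).differentiableWithinAt
  · filter_upwards [hψ] with z ⟨h1, h2⟩
    rw [h2, descendedMetric_tangentMap hp caratheodoryMetric_tangentMap_diffeomorph,
      caratheodoryMetric_tangentMap 1 h1]
    simp

theorem tangentMap_comp_curve {γ : ℂ → X} {m : ℂ → ℂ} {w : ℂ} (c : ℂ)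
    (hγ : MDifferentiableAt 𝓘(ℂ, ℂ) 𝓘(ℂ, E) γ (m w)) (hm : DifferentiableAt ℂ m w) :
    tangentMap 𝓘(ℂ, ℂ) 𝓘(ℂ, E) (γ ∘ m) ⟨w, c⟩ =
      tangentMap 𝓘(ℂ, ℂ) 𝓘(ℂ, E) γ ⟨m w, c * deriv m w⟩ := by
  rw [tangentMap_comp_at (p := (⟨w, c⟩ : TangentBundle 𝓘(ℂ, ℂ) ℂ)) hγ hm.mdifferentiableAt]
  congr 1
  refine tangentBundle_mk_congr rfl ?_
  have h : fderiv ℂ m w c = c * deriv m w := fderiv_eq_smul_deriv c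
  rw [← h, ← mfderiv_eq_fderiv]
  rfl

end

/-! ### Curvature comparison -/

section

variable {R : Type*} [TopologicalSpace R] [ChartedSpace ℂ R]

theorem descendedMetric_poincareMetric_tangentMap {q : unitDisc → R}
    (hq : IsHolomorphicGaloisCovering ℂ q) {ψ : ℂ → unitDisc} {z : ℂ} (c : ℂ)
    (hψ : MDifferentiableAt 𝓘(ℂ, ℂ) 𝓘(ℂ, ℂ) ψ z) :
    descendedMetric q poincareMetric
        (tangentMap 𝓘(ℂ, ℂ) 𝓘(ℂ, ℂ) q (tangentMap 𝓘(ℂ, ℂ) 𝓘(ℂ, ℂ) ψ ⟨z, c⟩)) =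
      ‖c‖ ^ 2 * hyperbolicDeriv (fun w => (ψ w : ℂ)) z ^ 2 := by
  rw [descendedMetric_tangentMap hq poincareMetric_tangentMap_diffeomorph,
    poincareMetric_tangentMap c hψ]

/-- The Gauss curvature of the metric induced by the Poincaré metric on a quotient of the disc is at
most `-4` at the image of `0`, in whatever holomorphic chart it is computed. -/
theorem gaussCurvature_descendedMetric_poincareMetric_le [IsManifold 𝓘(ℂ, ℂ) 1 R]
    {q : unitDisc → R} (hq : IsHolomorphicGaloisCovering ℂ q) :
    gaussCurvature (descendedMetric q poincareMetric) (q discZero) ≤ ((-4 : ℝ) : EReal) := by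
  set s := q discZero
  set e := chartAt ℂ s
  set w₀ : ℂ := e s
  have hs : s ∈ e.source := mem_chart_source ℂ s
  have hes : e.symm w₀ = s := e.left_inv hs
  have hγ : ∀ᶠ w in 𝓝 w₀, MDifferentiableAt 𝓘(ℂ, ℂ) 𝓘(ℂ, ℂ) e.symm w := by
    filter_upwards [e.open_target.mem_nhds (e.map_source hs)] with w hw
    exact ((contMDiffOn_chart_symm (I := 𝓘(ℂ, ℂ)) (n := 1)).contMDiffAt
      (e.open_target.mem_nhds hw)).mdifferentiableAt one_ne_zero
  obtain ⟨ψ, hψ0, hψ⟩ := exists_local_lift hq.isLocalBiholomorphism hγ hes.symm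
  -- The coordinate of the disc as a function of the chart; it pulls `g_Δ` back to the metric of `R`.
  set h : ℂ → ℂ := fun w => (ψ w : ℂ)
  have hcoef : ∀ᶠ w in 𝓝 w₀, metricCoefficient (descendedMetric q poincareMetric) s w =
      hyperbolicDeriv h w ^ 2 := by
    filter_upwards [hψ] with w ⟨h1, h2⟩
    rw [metricCoefficient, h2, descendedMetric_poincareMetric_tangentMap hq 1 h1]
    simp [h]
  have hd : ∀ᶠ w in 𝓝 w₀, DifferentiableAt ℂ h w := by
    filter_upwards [hψ] with w hw
    exact mdifferentiableAt_iff_differentiableAt.mp ((mdifferentiable_coe_unitDisc _).comp w hw.1)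
  have h0 : h w₀ = 0 := by simp only [h, hψ0]; rfl
  have h0' : deriv h w₀ ≠ 0 := by
    -- The coordinate `e`, read in the disc, is a left inverse of `h`.
    have he : MDifferentiableAt 𝓘(ℂ, ℂ) 𝓘(ℂ, ℂ) e (q (toDisc (h w₀))) := by
      rw [h0, toDisc_zero]
      exact (contMDiffAt_of_mem_maximalAtlas (n := 1)
        (IsManifold.chart_mem_maximalAtlas s) hs).mdifferentiableAt one_ne_zero
    have hk : MDifferentiableAt 𝓘(ℂ, ℂ) 𝓘(ℂ, ℂ) (e ∘ q ∘ toDisc) (h w₀) :=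
      MDifferentiableAt.comp (g := e) (h w₀) he (MDifferentiableAt.comp (g := q) (h w₀)
        (hq.isLocalBiholomorphism.mdifferentiable one_ne_zero _)
        (mdifferentiableAt_toDisc (norm_coe_lt_one _)))
    have hinv : (e ∘ q ∘ toDisc) ∘ h =ᶠ[𝓝 w₀] id := by
      filter_upwards [hψ, e.open_target.mem_nhds (e.map_source hs)] with w hw hwt
      have h1 : e.symm w = q (ψ w) := congrArg (fun u => u.1) (hw.2 0)
      simp only [h, Function.comp_apply, toDisc_coe, ← h1, id]
      exact e.right_inv hwt
    have h1 := hinv.deriv_eq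
    rw [deriv_comp w₀ (mdifferentiableAt_iff_differentiableAt.mp hk) hd.self_of_nhds,
      deriv_id] at h1
    exact right_ne_zero_of_mul_eq_one h1
  have hD : hyperbolicDeriv h w₀ = ‖deriv h w₀‖ := by simp [hyperbolicDeriv, h0]
  have hpos : 0 < ‖deriv h w₀‖ ^ 2 := by positivity
  have hlow := two_mul_sq_norm_deriv_le_lowerDDbar hd h0 h0'
  have hlog : (fun w => Real.log (metricCoefficient (descendedMetric q poincareMetric) s w))
      =ᶠ[𝓝 w₀] fun w => Real.log (hyperbolicDeriv h w ^ 2) :=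
    hcoef.mono fun w hw => congrArg Real.log hw
  rw [← lowerDDbar_congr hlog] at hlow
  have hmul := mul_le_mul_of_nonneg_left hlow
    (show (0 : EReal) ≤ ((2 / ‖deriv h w₀‖ ^ 2 : ℝ) : EReal) by
      exact_mod_cast (by positivity : (0 : ℝ) ≤ 2 / ‖deriv h w₀‖ ^ 2))
  rw [← EReal.coe_mul, show 2 / ‖deriv h w₀‖ ^ 2 * (2 * ‖deriv h w₀‖ ^ 2) = 4 by
    field_simp; norm_num] at hmul
  rw [gaussCurvature, hcoef.self_of_nhds, hD, EReal.coe_neg, EReal.neg_le_neg_iff]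
  exact hmul

end

section

variable {E : Type*} [NormedAddCommGroup E] [NormedSpace ℂ E]
  {X : Type*} [TopologicalSpace X] [ChartedSpace E X]
  {Y : Type*} [TopologicalSpace Y] [ChartedSpace E Y]
  {R : Type*} [TopologicalSpace R] [ChartedSpace ℂ R]

/-- The ratio of the pullback of a metric `g` by `Φ : Δ → X` and the Poincaré metric, as a function
on the disc. -/
noncomputable def poincareRatio (g : TangentBundle 𝓘(ℂ, E) X → ℝ) (Φ : unitDisc → X) (z : ℂ) : ℝ :=
  g (tangentMap 𝓘(ℂ, ℂ) 𝓘(ℂ, E) (Φ ∘ toDisc) ⟨z, (1 : ℂ)⟩) * (1 - ‖z‖ ^ 2) ^ 2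

theorem eventually_mdifferentiableAt_comp_toDisc {Φ : unitDisc → X}
    (hΦ : MDifferentiable 𝓘(ℂ, ℂ) 𝓘(ℂ, E) Φ) {z : ℂ} (hz : ‖z‖ < 1) :
    ∀ᶠ w in 𝓝 z, MDifferentiableAt 𝓘(ℂ, ℂ) 𝓘(ℂ, E) (Φ ∘ toDisc) w :=
  (eventually_norm_lt_one hz).mono fun w hw => (hΦ _).comp w (mdifferentiableAt_toDisc hw)

/-- The ratio is invariant under holomorphic reparametrizations that preserve the Poincaré metric
at the point in question. -/
theorem poincareRatio_comp {p : Y → X} (hp : IsHolomorphicGaloisCovering E p) {Φ : unitDisc → X}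
    (hΦ : MDifferentiable 𝓘(ℂ, ℂ) 𝓘(ℂ, E) Φ) {σ : unitDisc → unitDisc}
    (hσ : MDifferentiable 𝓘(ℂ, ℂ) 𝓘(ℂ, ℂ) σ) {z : ℂ} (hz : ‖z‖ < 1)
    (hiso : hyperbolicDeriv (fun w => (σ (toDisc w) : ℂ)) z ^ 2 = (1 / (1 - ‖z‖ ^ 2)) ^ 2) :
    poincareRatio (descendedMetric p (caratheodoryMetric E Y)) (Φ ∘ σ) z =
      poincareRatio (descendedMetric p (caratheodoryMetric E Y)) Φ (σ (toDisc z)) := by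
  set m : ℂ → ℂ := fun w => (σ (toDisc w) : ℂ)
  have hm : DifferentiableAt ℂ m z := mdifferentiableAt_iff_differentiableAt.mp
    ((mdifferentiable_coe_unitDisc _).comp z ((hσ _).comp z (mdifferentiableAt_toDisc hz)))
  have hmz : ‖m z‖ < 1 := norm_coe_lt_one _
  have hev := eventually_mdifferentiableAt_comp_toDisc hΦ hmz
  have hcomp : (Φ ∘ σ) ∘ toDisc = (Φ ∘ toDisc) ∘ m :=
    funext fun w => by simp [m, toDisc_coe]
  rw [poincareRatio, poincareRatio, hcomp, tangentMap_comp_curve 1 hev.self_of_nhds hm, one_mul,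
    descendedMetric_caratheodoryMetric_homogeneous hp hev]
  have h1 : 1 - ‖z‖ ^ 2 ≠ 0 := by nlinarith [norm_nonneg z]
  have h2 : 1 - ‖m z‖ ^ 2 ≠ 0 := by nlinarith [norm_nonneg (m z)]
  have h3 : ‖deriv m z‖ ^ 2 * (1 - ‖z‖ ^ 2) ^ 2 = (1 - ‖m z‖ ^ 2) ^ 2 := by
    rw [hyperbolicDeriv] at hiso
    field_simp at hiso
    linarith
  change _ = descendedMetric p (caratheodoryMetric E Y) (tangentMap 𝓘(ℂ, ℂ) 𝓘(ℂ, E) (Φ ∘ toDisc)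
    ⟨m z, (1 : ℂ)⟩) * (1 - ‖m z‖ ^ 2) ^ 2
  rw [← h3]
  ring

theorem continuousAt_poincareRatio {p : Y → X} (hp : IsHolomorphicGaloisCovering E p)
    {Φ : unitDisc → X} (hΦ : MDifferentiable 𝓘(ℂ, ℂ) 𝓘(ℂ, E) Φ) {z : ℂ} (hz : ‖z‖ < 1) :
    ContinuousAt (poincareRatio (descendedMetric p (caratheodoryMetric E Y)) Φ) z :=
  (continuousAt_descendedMetric_caratheodoryMetric hp
    (eventually_mdifferentiableAt_comp_toDisc hΦ hz)).mul (by fun_prop)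

/-- The pullback of the Carathéodory metric to a disc that factors through a compact quotient of the
disc attains its maximal ratio to the Poincaré metric. -/
theorem exists_max_poincareRatio {p : Y → X} (hp : IsHolomorphicGaloisCovering E p)
    [CompactSpace R] {q : unitDisc → R} (hq : IsHolomorphicGaloisCovering ℂ q) {φ : R → X}
    (hφ : MDifferentiable 𝓘(ℂ, ℂ) 𝓘(ℂ, E) φ) :
    ∃ a : ℂ, ‖a‖ < 1 ∧ ∀ z : ℂ, ‖z‖ < 1 →
      poincareRatio (descendedMetric p (caratheodoryMetric E Y)) (φ ∘ q) z ≤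
        poincareRatio (descendedMetric p (caratheodoryMetric E Y)) (φ ∘ q) a := by
  have hΦ := hφ.comp (hq.isLocalBiholomorphism.mdifferentiable one_ne_zero)
  set U := poincareRatio (descendedMetric p (caratheodoryMetric E Y)) (φ ∘ q)
  have hinv : ∀ x y : unitDisc, q x = q y → U x = U y := by
    intro x y hxy
    obtain ⟨σ, hσ, rfl⟩ := hq.deck_transitive x y hxy
    have hσd := σ.contMDiff.mdifferentiable one_ne_zero
    have hqσ : (φ ∘ q) ∘ σ = φ ∘ q := funext fun z => congrArg φ (hσ z)
    have hx := norm_coe_lt_one x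
    have h := poincareRatio_comp hp hΦ hσd hx (by
      have h1 := poincareMetric_tangentMap_diffeomorph σ
        (tangentMap 𝓘(ℂ, ℂ) 𝓘(ℂ, ℂ) toDisc ⟨(x : ℂ), (1 : ℂ)⟩)
      rw [← tangentMap_comp_at (p := (⟨(x : ℂ), (1 : ℂ)⟩ : TangentBundle 𝓘(ℂ, ℂ) ℂ)) (hσd _)
        (mdifferentiableAt_toDisc hx), poincareMetric_tangentMap 1
        ((hσd _).comp _ (mdifferentiableAt_toDisc hx)), poincareMetric_tangentMap_toDisc 1 hx] at h1
      simpa using h1)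
    rwa [hqσ, toDisc_coe] at h
  have hcont : Continuous fun x : unitDisc => U x := continuous_iff_continuousAt.mpr fun x =>
    (continuousAt_poincareRatio hp hΦ (norm_coe_lt_one x)).comp continuous_subtype_val.continuousAt
  -- By invariance `U` descends to `R`, where it is continuous as `q` is a quotient map.
  set u : R → ℝ := fun s => U (Function.surjInv hq.surjective s : unitDisc)
  have huq : ∀ x : unitDisc, u (q x) = U x := fun x =>
    hinv _ _ (Function.surjInv_eq hq.surjective (q x))
  have hucont : Continuous u :=
    (hq.isCoveringMap.isQuotientMap hq.surjective).continuous_iff.mpr (by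
      rwa [show u ∘ q = fun x : unitDisc => U x from funext huq])
  obtain ⟨s, -, hs⟩ := isCompact_univ.exists_isMaxOn ⟨q discZero, mem_univ _⟩ hucont.continuousOn
  refine ⟨(Function.surjInv hq.surjective s : unitDisc), norm_coe_lt_one _, fun z hz => ?_⟩
  rw [← coe_toDisc hz, ← huq]
  exact hs (mem_univ _)

/-- A negative upper bound of the holomorphic sectional curvature of the Carathéodory metric bounds
the ratio of its pullback by a disc and the Poincaré metric at a point of maximum. -/
theorem poincareRatio_le_of_isMax {p : Y → X} (hp : IsHolomorphicGaloisCovering E p)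
    {Φ : unitDisc → X} (hΦ : MDifferentiable 𝓘(ℂ, ℂ) 𝓘(ℂ, E) Φ) {k : ℝ} (hk : 0 < k)
    (hX : ∀ v : TangentBundle 𝓘(ℂ, E) X, v.2 ≠ 0 →
      holomorphicSectionalCurvature (descendedMetric p (caratheodoryMetric E Y)) v
        ≤ ((-k : ℝ) : EReal)) {a : ℂ} (ha : ‖a‖ < 1)
    (hmax : ∀ z : ℂ, ‖z‖ < 1 →
      poincareRatio (descendedMetric p (caratheodoryMetric E Y)) Φ z ≤
        poincareRatio (descendedMetric p (caratheodoryMetric E Y)) Φ a) :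
    poincareRatio (descendedMetric p (caratheodoryMetric E Y)) Φ a ≤ 4 / k := by
  set g := descendedMetric p (caratheodoryMetric E Y) with hg
  rcases le_or_gt (poincareRatio g Φ a) 0 with h | hpos
  · exact h.trans (by positivity)
  -- Precomposition with a Möbius transformation moves the maximum to the centre of the disc.
  have hna : ‖-a‖ < 1 := by simpa
  have h00 : ‖(0 : ℂ)‖ < 1 := by simp
  set σ : unitDisc → unitDisc := fun x => toDisc (discMoebius (-a) x)
  have hcoe : ∀ w : ℂ, ‖w‖ < 1 → (σ (toDisc w) : ℂ) = discMoebius (-a) w := fun w hw => by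
    simp only [σ, coe_toDisc hw]
    exact coe_toDisc (norm_discMoebius_lt_one hna hw)
  have hσ : MDifferentiable 𝓘(ℂ, ℂ) 𝓘(ℂ, ℂ) σ := fun x =>
    (mdifferentiableAt_toDisc (norm_discMoebius_lt_one hna (norm_coe_lt_one x))).comp x
      ((hasDerivAt_discMoebius hna
        (norm_coe_lt_one x)).differentiableAt.mdifferentiableAt.comp x
          (mdifferentiable_coe_unitDisc x))
  have hΦσ : MDifferentiable 𝓘(ℂ, ℂ) 𝓘(ℂ, E) (Φ ∘ σ) := hΦ.comp hσ
  have hratio : ∀ w : ℂ, ‖w‖ < 1 →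
      poincareRatio g (Φ ∘ σ) w = poincareRatio g Φ (discMoebius (-a) w) := fun w hw => by
    rw [hg, poincareRatio_comp hp hΦ hσ hw, hcoe w hw]
    have heq : (fun w => (σ (toDisc w) : ℂ)) =ᶠ[𝓝 w] discMoebius (-a) :=
      (eventually_norm_lt_one hw).mono hcoe
    rw [hyperbolicDeriv, heq.deriv_eq, hcoe w hw, ← hyperbolicDeriv,
      hyperbolicDeriv_discMoebius hna hw]
  set G : ℂ → ℝ := fun w =>
    g (tangentMap 𝓘(ℂ, ℂ) 𝓘(ℂ, E) ((Φ ∘ σ) ∘ toDisc) ⟨w, (1 : ℂ)⟩) with hG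
  have hG0 : G 0 = poincareRatio g Φ a := by
    have := hratio 0 h00
    rw [discMoebius_zero, neg_neg] at this
    rw [← this]
    simp [poincareRatio, hG]
  have hG0' : 0 < G 0 := by rwa [hG0]
  have hGle : ∀ w : ℂ, ‖w‖ < 1 → G w ≤ G 0 / (1 - ‖w‖ ^ 2) ^ 2 := fun w hw => by
    have h1 : 0 < 1 - ‖w‖ ^ 2 := by nlinarith [norm_nonneg w]
    rw [le_div_iff₀ (by positivity), hG0]
    exact (hratio w hw).trans_le (hmax _ (norm_discMoebius_lt_one hna hw))
  have hcoef : ∀ w : ℂ, ‖w‖ < 1 →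
      metricCoefficient (g ∘ tangentMap 𝓘(ℂ, ℂ) 𝓘(ℂ, E) (Φ ∘ σ)) discZero w = G w := fun w hw => by
    rw [hG]
    simp only
    rw [tangentMap_comp_at (p := (⟨w, (1 : ℂ)⟩ : TangentBundle 𝓘(ℂ, ℂ) ℂ)) (hΦσ _)
      (mdifferentiableAt_toDisc hw)]
    rfl
  have hdd := lowerDDbar_log_le_two
    ((eventually_norm_lt_one h00).mono fun w hw =>
      continuousAt_descendedMetric_caratheodoryMetric hp
        (eventually_mdifferentiableAt_comp_toDisc hΦσ hw))
    (G := G) hG0' ((eventually_norm_lt_one h00).mono hGle)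
  have hchart : chartAt ℂ discZero discZero = 0 := rfl
  have hK : ((-(4 / G 0) : ℝ) : EReal) ≤
      gaussCurvature (g ∘ tangentMap 𝓘(ℂ, ℂ) 𝓘(ℂ, E) (Φ ∘ σ)) discZero := by
    rw [gaussCurvature, hchart, hcoef 0 h00, EReal.coe_neg, EReal.neg_le_neg_iff,
      lowerDDbar_congr ((eventually_norm_lt_one h00).mono fun w hw => by rw [hcoef w hw])]
    have := mul_le_mul_of_nonneg_left hdd
      (show (0 : EReal) ≤ ((2 / G 0 : ℝ) : EReal) by
        exact_mod_cast (by positivity : (0 : ℝ) ≤ 2 / G 0))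
    refine this.trans_eq ?_
    rw [show (2 : EReal) = ((2 : ℝ) : EReal) from rfl, ← EReal.coe_mul]
    congr 1
    ring
  set v := tangentMap 𝓘(ℂ, ℂ) 𝓘(ℂ, E) ((Φ ∘ σ) ∘ toDisc) ⟨0, (1 : ℂ)⟩ with hv
  -- The disc is an immersion at `0` because the pulled back metric is positive there.
  have hv2 : v.2 ≠ 0 := fun h0 => by
    have hev := eventually_mdifferentiableAt_comp_toDisc hΦσ h00
    have h1 : v = tangentMap 𝓘(ℂ, ℂ) 𝓘(ℂ, E) ((Φ ∘ σ) ∘ toDisc) ⟨0, (0 : ℂ)⟩ :=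
      tangentBundle_mk_congr rfl (h0.trans (map_zero _).symm)
    have h2 : G 0 = 0 := by
      change g v = 0
      rw [h1, hg, descendedMetric_caratheodoryMetric_homogeneous hp hev]
      simp
    rw [← hG0, h2] at hpos
    exact hpos.false
  have hvc : ∃ c : ℂ, tangentMap 𝓘(ℂ, ℂ) 𝓘(ℂ, E) (Φ ∘ σ) ⟨discZero, c⟩ = v := by
    refine ⟨(tangentMap 𝓘(ℂ, ℂ) 𝓘(ℂ, ℂ) toDisc ⟨0, (1 : ℂ)⟩).2, ?_⟩
    rw [hv, tangentMap_comp_at (p := (⟨0, (1 : ℂ)⟩ : TangentBundle 𝓘(ℂ, ℂ) ℂ)) (hΦσ _)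
      (mdifferentiableAt_toDisc h00)]
    congr 1
    exact tangentBundle_mk_congr toDisc_zero.symm rfl
  have hle := hK.trans ((le_iSup (fun f : {f : unitDisc → X // MDifferentiable 𝓘(ℂ, ℂ) 𝓘(ℂ, E) f ∧
      ∃ c : ℂ, tangentMap 𝓘(ℂ, ℂ) 𝓘(ℂ, E) f ⟨discZero, c⟩ = v} =>
    gaussCurvature (g ∘ tangentMap 𝓘(ℂ, ℂ) 𝓘(ℂ, E) f.1) discZero) ⟨Φ ∘ σ, hΦσ, hvc⟩).trans
      (hX v hv2))
  rw [EReal.coe_le_coe_iff, neg_le_neg_iff, hG0, le_div_iff₀ hpos] at hle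
  rw [le_div_iff₀ hk]
  linarith

end

theorem mainTheorem4
    {E : Type*} [NormedAddCommGroup E] [NormedSpace ℂ E] [FiniteDimensional ℂ E]
    -- the complex manifold `X`, covered by the complex manifold `Y`
    {X : Type*} [TopologicalSpace X] [T2Space X] [ChartedSpace E X] [IsManifold 𝓘(ℂ, E) 1 X]
    {Y : Type*} [TopologicalSpace Y] [T2Space Y] [ChartedSpace E Y] [IsManifold 𝓘(ℂ, E) 1 Y]
    (p : Y → X) (hp : IsHolomorphicGaloisCovering E p)
    (hY : NondegenerateMetric (caratheodoryMetric E Y))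
    -- the compact Riemann surface `R = Δ / Γ`
    {R : Type*} [TopologicalSpace R] [T2Space R] [CompactSpace R] [ChartedSpace ℂ R]
    [IsManifold 𝓘(ℂ, ℂ) 1 R]
    (q : unitDisc → R) (hq : IsHolomorphicGaloisCovering ℂ q)
    (φ : R → X) (hφ : MDifferentiable 𝓘(ℂ, ℂ) 𝓘(ℂ, E) φ) (hφ' : ∃ a b, φ a ≠ φ b)
    (kR kC : ℝ) (hkR : 0 < kR) (hkC : 0 < kC)
    (hR : ∀ s : R, ((-kR : ℝ) : EReal) ≤ gaussCurvature (descendedMetric q poincareMetric) s)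
    (hX : ∀ v : TangentBundle 𝓘(ℂ, E) X, v.2 ≠ 0 →
      holomorphicSectionalCurvature (descendedMetric p (caratheodoryMetric E Y)) v
        ≤ ((-kC : ℝ) : EReal))
    (v : TangentBundle 𝓘(ℂ, ℂ) R) :
    descendedMetric p (caratheodoryMetric E Y) (tangentMap 𝓘(ℂ, ℂ) 𝓘(ℂ, E) φ v)
      ≤ kR / kC * descendedMetric q poincareMetric v := by
  have hq1 := hq.isLocalBiholomorphism.mdifferentiable one_ne_zero
  have hk : 4 ≤ kR := by
    have h := (hR (q discZero)).trans (gaussCurvature_descendedMetric_poincareMetric_le hq)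
    rw [EReal.coe_le_coe_iff] at h
    linarith
  have hΦ := hφ.comp hq1
  obtain ⟨a, ha, hmax⟩ := exists_max_poincareRatio hp hq hφ
  have hbound := poincareRatio_le_of_isMax hp hΦ hkC hX ha hmax
  obtain ⟨z, c, hz, hv⟩ : ∃ z c : ℂ, ‖z‖ < 1 ∧
      v = tangentMap 𝓘(ℂ, ℂ) 𝓘(ℂ, ℂ) q (tangentMap 𝓘(ℂ, ℂ) 𝓘(ℂ, ℂ) toDisc ⟨z, c⟩) := by
    obtain ⟨s, b⟩ := v
    obtain ⟨x, rfl⟩ := hq.surjective s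
    set A := (hq.isLocalBiholomorphism x).mfderivToContinuousLinearEquiv one_ne_zero
    obtain ⟨b', rfl⟩ := A.surjective b
    obtain ⟨z, c, hz, h⟩ := exists_eq_tangentMap_toDisc ⟨x, b'⟩
    refine ⟨z, c, hz, ?_⟩
    rw [← h]
    refine tangentBundle_mk_congr rfl ?_
    rw [← (hq.isLocalBiholomorphism x).mfderivToContinuousLinearEquiv_coe one_ne_zero]
    rfl
  have hratio := (hmax z hz).trans (hbound.trans (div_le_div_of_nonneg_right hk hkC.le))
  have hpos : 0 < 1 - ‖z‖ ^ 2 := by nlinarith [norm_nonneg z]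
  rw [poincareRatio, ← le_div_iff₀ (by positivity)] at hratio
  have hz1 := mdifferentiableAt_toDisc hz
  rw [hv, descendedMetric_poincareMetric_tangentMap hq c hz1, hyperbolicDeriv_toDisc hz,
    ← tangentMap_comp_at (p := (⟨z, c⟩ : TangentBundle 𝓘(ℂ, ℂ) ℂ)) (hq1 _) hz1,
    ← tangentMap_comp_at (p := (⟨z, c⟩ : TangentBundle 𝓘(ℂ, ℂ) ℂ)) (hφ _) ((hq1 _).comp z hz1),
    ← Function.comp_assoc, descendedMetric_caratheodoryMetric_homogeneous hp
      (eventually_mdifferentiableAt_comp_toDisc hΦ hz)]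
  calc _ ≤ ‖c‖ ^ 2 * (kR / kC / (1 - ‖z‖ ^ 2) ^ 2) := by gcongr
    _ = _ := by rw [one_div, inv_pow]; ring
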